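/- Let $n\ge 2$ and write $x=(x',x_n)\in\mathbb R^{n-1}\times\mathbb R$. For an open set $D\subset\mathbb R^n$, $s\in(0,1)$ and $p\in(1,\infty)$ put $$[u]^p_{\mathcal X^{s,p}(D)}=\int_D\int_D \frac{\left|(u(y)-u(x))\cdot\frac{y-x}{|y-x|}\right|^p}{|y-x|^{n+ps}}\,dy\,dx ,$$ and let $\mathcal X^{s,p}(D)$ be the closure of $C^1_c(\overline D;\mathbb R^n)$ (the fields that are $C^1$ up to the boundary of $D$ and whose support is a compact subset of $\overline D$; they need not vanish on $\partial D$) with respect to the norm $\|u\|_{L^p(D)}+[u]_{\mathcal X^{s,p}(D)}$. There is a constant $c_2=c_2(n)\ge 1$, depending only on $n$, such that for all $s\in(0,1)$, $p\in(1,\infty)$ (including the case $ps=1$) and $M\ge 0$ there is a constant $C=C(n,p,s,M)>0$ with the following property. Let $f:\mathbb R^{n-1}\to\mathbb R$ be Lipschitz with Lipschitz constant $\le M$, let $D=\{(x',x_n): x_n>f(x')\}$ be its epigraph, and let $\delta=\frac{1}{2c_2\sqrt n\,(2+M)}$. Then for all $\lambda,\mu\in[1-\delta,1+\delta]$ and all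 $u\in\mathcal X^{s,p}(D)$, $$\int_D\frac{\left|u_n\big(x',f(x')+\lambda(x_n-f(x'))\big)-u_n\big(x',f(x')+\mu(x_n-f(x'))\big)\right|^p}{|x_n-f(x')|^{ps}}\,dx\le C\,[u]^p_{\mathcal X^{s,p}(D)} .$$ -/

import Mathlib

open MeasureTheory
open scoped ENNReal NNReal

/-! We work in `ℝⁿ` with `n = m + 1`; points are `x = (x', xₙ)` with `x' ∈ ℝᵐ = ℝⁿ⁻¹`. -/

namespace FracKorn

noncomputable section

/-- Euclidean space `ℝᵏ`, with the Euclidean norm and Lebesgue measure. -/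
abbrev E (k : ℕ) : Type := EuclideanSpace ℝ (Fin k)

/-- The first `n - 1` coordinates `x'` of `x = (x', xₙ)`. -/
def horiz {m : ℕ} (x : E (m + 1)) : E m :=
  WithLp.toLp 2 (fun i : Fin m => x i.castSucc)

/-- The last coordinate `xₙ` of `x = (x', xₙ)`. -/
def vert {m : ℕ} (x : E (m + 1)) : ℝ := x (Fin.last m)

/-- The point `(x', t)`. -/
def mkPt {m : ℕ} (x' : E m) (t : ℝ) : E (m + 1) :=
  WithLp.toLp 2 (Fin.snoc (α := fun _ => ℝ) (fun i : Fin m => x' i) t)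

/-- The epigraph `{(x', xₙ) : xₙ > f x'}` supported by `f`. -/
def epigraph {m : ℕ} (f : E m → ℝ) : Set (E (m + 1)) :=
  {x | f (horiz x) < vert x}

/-- The map `(x', xₙ) ↦ (x', f x' + η (xₙ - f x'))`. -/
def stretch {m : ℕ} (f : E m → ℝ) (η : ℝ) (x : E (m + 1)) : E (m + 1) :=
  mkPt (horiz x) (f (horiz x) + η * (vert x - f (horiz x)))

/-- The `p`-th power of the seminorm of `𝒳^{s,p}(D)`,
`∫_D ∫_D |(u y - u x) · (y - x)/|y - x||^p / |y - x|^(n + p s) dy dx`, as a value in `[0, ∞]`.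
On the (null) diagonal the integrand is `0`. -/
def semiPow {n : ℕ} (s p : ℝ) (D : Set (E n)) (u : E n → E n) : ℝ≥0∞ :=
  ∫⁻ x in D, ∫⁻ y in D,
    ENNReal.ofReal
      (|inner ℝ (u y - u x) (‖y - x‖⁻¹ • (y - x))| ^ p / ‖y - x‖ ^ ((n : ℝ) + p * s))

/-- The norm `‖u‖_{L^p(D)} + [u]_{𝒳^{s,p}(D)}`, as a value in `[0, ∞]`. -/
def normX {n : ℕ} (s p : ℝ) (D : Set (E n)) (u : E n → E n) : ℝ≥0∞ :=
  eLpNorm u (ENNReal.ofReal p) (volume.restrict D) + semiPow s p D u ^ p⁻¹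

/-- `φ ∈ C¹_c(closure D; ℝⁿ)`: `φ` is `C¹` up to the boundary of `D` and vanishes, on `closure D`,
outside a compact subset of `closure D`. It need not vanish on the boundary of `D`. -/
def IsC1c {n : ℕ} (D : Set (E n)) (φ : E n → E n) : Prop :=
  ContDiffOn ℝ 1 φ (closure D) ∧
    ∃ K : Set (E n), IsCompact K ∧ K ⊆ closure D ∧ ∀ x ∈ closure D, x ∉ K → φ x = 0

/-- `u ∈ 𝒳^{s,p}(D)`: `u` is a (measurable) field of finite norm that lies in the closure of
`C¹_c(closure D; ℝⁿ)` for that norm. Only the values of `u` on `D` matter. -/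
def MemX {n : ℕ} (s p : ℝ) (D : Set (E n)) (u : E n → E n) : Prop :=
  AEStronglyMeasurable u (volume.restrict D) ∧ normX s p D u < ∞ ∧
    ∀ ε : ℝ≥0∞, 0 < ε → ∃ φ : E n → E n, IsC1c D φ ∧ normX s p D (u - φ) < ε

end

end FracKorn

/-! On the vertical line through `x`, at height `d` above the graph, let `X`, `Y`, `Z` be the points
at heights `lam * d`, `mu * d`, `2 * d`. For small `w`, the points `X`, `Y`, `Z - w`, `Z + w` form a
complete planar framework, which carries a self-stress: the difference of `u` between `X` and `Y`
along their common line is a linear combination of the differences along the other five edges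
(`stress_identity`). Since `lam` and `mu` stay away from 2, its coefficient does not degenerate,
even when `lam` and `mu` are close. All edges have length at most `3 * d`, so each of the five terms
is controlled by the kernel of the seminorm (`abs_vert_sub_le`).

Averaging over `w` in a ball of radius `d / (1 + M)`, which keeps `Z ± w` in the epigraph, divides
by a volume of order `d ^ n` and absorbs the factor `d ^ n` of the kernel
(`ofReal_abs_vert_sub_rpow_le_lintegral`). Integrating in `x` and changing variables turns each term
into a multiple of the seminorm (`setLIntegral_abs_vert_sub_rpow_le`). No Hardy inequality enters,
so `p * s = 1` is not special. -/

namespace FracKorn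

/-! ### Coordinates and geometry of the epigraph -/

/-- The last vector of the standard basis. -/
noncomputable def lastVec (m : ℕ) : E (m + 1) := EuclideanSpace.single (Fin.last m) 1

/-- The height of `x` above the graph of `f`. -/
noncomputable def height {m : ℕ} (f : E m → ℝ) (x : E (m + 1)) : ℝ := vert x - f (horiz x)

lemma vert_add {m : ℕ} (x y : E (m + 1)) : vert (x + y) = vert x + vert y := by
  simp [vert]

lemma vert_sub {m : ℕ} (x y : E (m + 1)) : vert (x - y) = vert x - vert y := by
  simp [vert]

lemma norm_lastVec (m : ℕ) : ‖lastVec m‖ = 1 := by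
  simp [lastVec]

lemma inner_lastVec {m : ℕ} (x : E (m + 1)) : inner ℝ x (lastVec m) = vert x := by
  simp [lastVec, vert, EuclideanSpace.inner_single_right]

lemma horiz_mkPt {m : ℕ} (x' : E m) (t : ℝ) : horiz (mkPt x' t) = x' := by
  ext i
  simp [horiz, mkPt]

lemma vert_mkPt {m : ℕ} (x' : E m) (t : ℝ) : vert (mkPt x' t) = t := by
  simp [vert, mkPt]

lemma stretch_eq_add {m : ℕ} (f : E m → ℝ) (η : ℝ) (x : E (m + 1)) :
    stretch f η x = x + ((η - 1) * height f x) • lastVec m := by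
  ext i
  refine Fin.lastCases ?_ (fun j => ?_) i
  · simp [stretch, mkPt, lastVec, height, vert]
    ring
  · simp [stretch, mkPt, lastVec, horiz, Fin.castSucc_ne_last]

lemma height_stretch {m : ℕ} (f : E m → ℝ) (η : ℝ) (x : E (m + 1)) :
    height f (stretch f η x) = η * height f x := by
  simp [height, stretch, horiz_mkPt, vert_mkPt]

lemma mem_epigraph_iff {m : ℕ} (f : E m → ℝ) (x : E (m + 1)) :
    x ∈ epigraph f ↔ 0 < height f x := by
  simp [epigraph, height]

lemma stretch_mem_epigraph_iff {m : ℕ} (f : E m → ℝ) {η : ℝ} (hη : 0 < η) (x : E (m + 1)) :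
    stretch f η x ∈ epigraph f ↔ x ∈ epigraph f := by
  simp [mem_epigraph_iff, height_stretch, hη]

lemma norm_horiz_le {m : ℕ} (x : E (m + 1)) : ‖horiz x‖ ≤ ‖x‖ := by
  rw [EuclideanSpace.norm_eq, EuclideanSpace.norm_eq]
  refine Real.sqrt_le_sqrt ?_
  rw [Fin.sum_univ_castSucc]
  simp only [horiz]
  nlinarith [sq_nonneg ‖x (Fin.last m)‖]

lemma abs_vert_le {m : ℕ} (x : E (m + 1)) : |vert x| ≤ ‖x‖ := by
  simpa [vert] using PiLp.norm_apply_le x (Fin.last m)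

lemma horiz_add {m : ℕ} (x y : E (m + 1)) : horiz (x + y) = horiz x + horiz y := by
  ext i
  simp [horiz]

/-- The height is Lipschitz with constant `1 + M`, so a shift by `w` cannot reach the graph. -/
lemma add_mem_epigraph {m : ℕ} {f : E m → ℝ} {M : ℝ≥0} (hf : LipschitzWith M f)
    {x w : E (m + 1)} (hw : (1 + M) * ‖w‖ < height f x) : x + w ∈ epigraph f := by
  rw [mem_epigraph_iff]
  have h1 := hf.dist_le_mul (horiz (x + w)) (horiz x)
  rw [dist_eq_norm, dist_eq_norm, horiz_add, add_sub_cancel_left, Real.norm_eq_abs] at h1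
  have h2 := mul_le_mul_of_nonneg_left (norm_horiz_le w) M.coe_nonneg
  have h3 := abs_le.1 (abs_vert_le w)
  have h4 := abs_le.1 h1
  simp only [height, vert_add, horiz_add] at *
  linarith [h4.2, h3.1]

lemma continuous_horiz {m : ℕ} : Continuous (horiz (m := m)) := by
  unfold horiz
  fun_prop

lemma continuous_vert {m : ℕ} : Continuous (vert (m := m)) := by
  unfold vert
  fun_prop

lemma continuous_height {m : ℕ} {f : E m → ℝ} (hf : Continuous f) : Continuous (height f) :=
  continuous_vert.sub (hf.comp continuous_horiz)

lemma continuous_stretch {m : ℕ} {f : E m → ℝ} (hf : Continuous f) (η : ℝ) :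
    Continuous (stretch f η) := by
  rw [show stretch f η = fun x => x + ((η - 1) * height f x) • lastVec m from
    funext (stretch_eq_add f η)]
  have := continuous_height hf
  fun_prop

lemma measurableSet_epigraph {m : ℕ} {f : E m → ℝ} (hf : Continuous f) :
    MeasurableSet (epigraph f) :=
  (isOpen_lt (hf.comp continuous_horiz) continuous_vert).measurableSet

/-! ### Change of variables under vertical stretching -/

/-- Tonelli's theorem in the coordinates `(x', xₙ)`. -/
lemma lintegral_eq_lintegral_mkPt {m : ℕ} {g : E (m + 1) → ℝ≥0∞} (hg : Measurable g) :
    ∫⁻ x, g x = ∫⁻ y : Fin m → ℝ, ∫⁻ t : ℝ, g (mkPt (WithLp.toLp 2 y) t) := by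
  have h := (PiLp.volume_preserving_toLp (Fin (m + 1))).comp
    (volume_preserving_piFinSuccAbove (fun _ : Fin (m + 1) => ℝ) (Fin.last m)).symm
  have hm : Measurable fun z : ℝ × (Fin m → ℝ) => g ((WithLp.toLp 2 ∘
      (MeasurableEquiv.piFinSuccAbove (fun _ : Fin (m + 1) => ℝ) (Fin.last m)).symm) z) :=
    hg.comp h.measurable
  rw [← h.lintegral_comp hg, Measure.volume_eq_prod, lintegral_prod_symm' _ hm]
  refine lintegral_congr fun y => lintegral_congr fun t => ?_
  simp only [Function.comp_apply]
  congr 1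
  ext i
  refine Fin.lastCases ?_ (fun j => ?_) i
  · simp [mkPt, MeasurableEquiv.piFinSuccAbove]
  · simp [mkPt, MeasurableEquiv.piFinSuccAbove]

lemma lintegral_comp_smul_real {F : Type*} [NormedAddCommGroup F] [InnerProductSpace ℝ F]
    [FiniteDimensional ℝ F] [MeasurableSpace F] [BorelSpace F] {g : F → ℝ≥0∞}
    (hg : Measurable g) {r : ℝ} (hr : 0 < r) :
    ∫⁻ x, g (r • x) = ENNReal.ofReal (r ^ Module.finrank ℝ F)⁻¹ * ∫⁻ x, g x := by
  have h := lintegral_map (μ := volume) hg (measurable_const_smul (α := F) r)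
  rw [← h, Measure.map_addHaar_smul _ hr.ne', lintegral_smul_measure,
    abs_of_pos (by positivity), smul_eq_mul]

/-- On each vertical line the map is a dilation by `η` about the graph, so Tonelli gives the
Jacobian without differentiating `f`. -/
lemma lintegral_comp_stretch {m : ℕ} {f : E m → ℝ} (hf : Continuous f) {η : ℝ} (hη : 0 < η)
    {g : E (m + 1) → ℝ≥0∞} (hg : Measurable g) :
    ∫⁻ x, g (stretch f η x) = ENNReal.ofReal η⁻¹ * ∫⁻ x, g x := by
  have hs := (continuous_stretch hf η).measurable
  have hmk (y : E m) : Measurable fun t => mkPt y t := by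
    refine Continuous.measurable ?_
    have : (fun t => mkPt y t) = fun t => mkPt y 0 + t • lastVec m := by
      ext t i
      refine Fin.lastCases ?_ (fun j => ?_) i
      · simp [mkPt, lastVec]
      · simp [mkPt, lastVec, Fin.castSucc_ne_last]
    rw [this]
    fun_prop
  have hgs : Measurable fun x => g (stretch f η x) := hg.comp hs
  rw [lintegral_eq_lintegral_mkPt hgs, lintegral_eq_lintegral_mkPt hg,
    ← lintegral_const_mul' _ _ ENNReal.ofReal_ne_top]
  refine lintegral_congr fun y => ?_
  set y' : E m := WithLp.toLp 2 y
  have hgy : Measurable fun t => g (mkPt y' t) := hg.comp (hmk y')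
  have e (t : ℝ) : g (stretch f η (mkPt y' t)) = g (mkPt y' (f y' + η • (t - f y'))) := by
    simp [stretch, horiz_mkPt, vert_mkPt]
  simp only [e]
  rw [lintegral_sub_right_eq_self (fun t => g (mkPt y' (f y' + η • t))) (f y'),
    lintegral_comp_smul_real (g := fun t => g (mkPt y' (f y' + t)))
      (hgy.comp (measurable_const_add _)) hη,
    lintegral_add_left_eq_self (fun t => g (mkPt y' t)) (f y')]
  simp

lemma setLIntegral_comp_stretch {m : ℕ} {f : E m → ℝ} (hf : Continuous f) {η : ℝ} (hη : 0 < η)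
    {g : E (m + 1) → ℝ≥0∞} (hg : Measurable g) :
    ∫⁻ x in epigraph f, g (stretch f η x) = ENNReal.ofReal η⁻¹ * ∫⁻ x in epigraph f, g x := by
  have hD := measurableSet_epigraph hf
  rw [← lintegral_indicator hD, ← lintegral_indicator hD,
    ← lintegral_comp_stretch hf hη (hg.indicator hD)]
  refine lintegral_congr fun x => ?_
  by_cases hx : x ∈ epigraph f
  · rw [Set.indicator_of_mem hx, Set.indicator_of_mem ((stretch_mem_epigraph_iff f hη x).2 hx)]
  · rw [Set.indicator_of_notMem hx,
      Set.indicator_of_notMem (mt (stretch_mem_epigraph_iff f hη x).1 hx)]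

/-- Allows `u` to be replaced by a measurable representative inside `u (stretch f η x)`. -/
lemma ae_comp_stretch {m : ℕ} {f : E m → ℝ} (hf : Continuous f) {η : ℝ} (hη : 0 < η)
    {q : E (m + 1) → Prop} (hq : ∀ᵐ x ∂volume.restrict (epigraph f), q x) :
    ∀ᵐ x ∂volume.restrict (epigraph f), q (stretch f η x) := by
  have hs := (continuous_stretch hf η).measurable
  have hac : Measure.map (stretch f η) (volume.restrict (epigraph f)) ≪
      volume.restrict (epigraph f) := by
    refine Measure.AbsolutelyContinuous.mk fun N hN h0 => ?_
    rw [← lintegral_indicator_one hN, lintegral_map (measurable_one.indicator hN) hs,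
      setLIntegral_comp_stretch hf hη (measurable_one.indicator hN),
      lintegral_indicator_one hN, h0, mul_zero]
  exact ae_of_ae_map hs.aemeasurable (hac.ae_le hq)

/-! ### Directional differences and the self-stress -/

/-- The modulus of the difference of `u` along the direction from `x` to `y`. -/
noncomputable def projDiff {n : ℕ} (u : E n → E n) (x y : E n) : ℝ :=
  |inner ℝ (u y - u x) (‖y - x‖⁻¹ • (y - x))|

/-- The integrand of `semiPow`. -/
noncomputable def kern {n : ℕ} (s p : ℝ) (u : E n → E n) (x y : E n) : ℝ≥0∞ :=
  ENNReal.ofReal (projDiff u x y ^ p / ‖y - x‖ ^ ((n : ℝ) + p * s))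

lemma semiPow_eq {n : ℕ} (s p : ℝ) (D : Set (E n)) (u : E n → E n) :
    semiPow s p D u = ∫⁻ x in D, ∫⁻ y in D, kern s p u x y := rfl

lemma projDiff_nonneg {n : ℕ} (u : E n → E n) (x y : E n) : 0 ≤ projDiff u x y := abs_nonneg _

lemma abs_inner_eq_norm_mul_projDiff {n : ℕ} (u : E n → E n) (x y : E n) :
    |inner ℝ (u y - u x) (y - x)| = ‖y - x‖ * projDiff u x y := by
  rcases eq_or_ne (y - x) 0 with h | h
  · simp [h]
  · have h' : 0 < ‖y - x‖ := norm_pos_iff.2 h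
    rw [projDiff, inner_smul_right, abs_mul, abs_of_pos (inv_pos.2 h'),
      mul_inv_cancel_left₀ h'.ne']

lemma projDiff_rpow_le {n : ℕ} (u : E n → E n) {x y : E n} {p q R : ℝ} (hp : 0 < p) (hq : 0 ≤ q)
    (hR : ‖y - x‖ ≤ R) :
    projDiff u x y ^ p ≤ R ^ q * (projDiff u x y ^ p / ‖y - x‖ ^ q) := by
  rcases eq_or_ne (y - x) 0 with h | h
  · simp [projDiff, h, Real.zero_rpow hp.ne']
  · have h' : 0 < ‖y - x‖ := norm_pos_iff.2 h
    have h1 : ‖y - x‖ ^ q ≤ R ^ q := Real.rpow_le_rpow h'.le hR hq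
    have h2 : 0 < ‖y - x‖ ^ q := Real.rpow_pos_of_pos h' q
    have h3 : 0 ≤ projDiff u x y ^ p := Real.rpow_nonneg (projDiff_nonneg u x y) p
    rw [mul_div_assoc', le_div_iff₀ h2, mul_comm]
    exact mul_le_mul_of_nonneg_right h1 h3

/-- The self-stress of the planar framework formed by two points of a line through `z` and the
points `z - w`, `z + w`: the difference along the line is a combination of the other five
differences. -/
lemma stress_identity {F : Type*} [NormedAddCommGroup F] [InnerProductSpace ℝ F]
    (a b v₁ v₂ e w : F) (lam mu κ d : ℝ) :
    (κ - mu) * (lam - κ) * d * inner ℝ (a - b) e =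
      (κ - mu) / 2 * (inner ℝ (v₁ - a) (((κ - lam) * d) • e + w)
        + inner ℝ (v₂ - a) (((κ - lam) * d) • e - w))
      + (lam - κ) / 2 * (inner ℝ (v₁ - b) (((κ - mu) * d) • e + w)
        + inner ℝ (v₂ - b) (((κ - mu) * d) • e - w))
      - (lam - mu) / 4 * inner ℝ (v₁ - v₂) ((2 : ℝ) • w) := by
  simp only [inner_sub_left, inner_add_right, inner_sub_right, inner_smul_right]
  ring

lemma abs_vert_sub_le {m : ℕ} (f : E m → ℝ) (u : E (m + 1) → E (m + 1)) {lam mu : ℝ}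
    (hlam : |lam - 1| ≤ 1 / 4) (hmu : |mu - 1| ≤ 1 / 4) {x w : E (m + 1)}
    (hx : x ∈ epigraph f) (hw : ‖w‖ ≤ height f x) :
    let X := stretch f lam x
    let Y := stretch f mu x
    let Z := stretch f 2 x
    |vert (u X) - vert (u Y)| ≤ 6 * (projDiff u X (Z + w) + projDiff u X (Z - w)
      + projDiff u Y (Z + w) + projDiff u Y (Z - w) + projDiff u (Z - w) (Z + w)) ∧
    ‖Z + w - X‖ ≤ 3 * height f x ∧ ‖Z - w - X‖ ≤ 3 * height f x ∧
    ‖Z + w - Y‖ ≤ 3 * height f x ∧ ‖Z - w - Y‖ ≤ 3 * height f x ∧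
    ‖Z + w - (Z - w)‖ ≤ 3 * height f x := by
  intro X Y Z
  rw [mem_epigraph_iff] at hx
  set d := height f x
  obtain ⟨l1, l2⟩ := abs_le.1 hlam
  obtain ⟨m1, m2⟩ := abs_le.1 hmu
  have eX : Z - X = ((2 - lam) * d) • lastVec m := by
    simp only [X, Z, stretch_eq_add]
    module
  have eY : Z - Y = ((2 - mu) * d) • lastVec m := by
    simp only [Y, Z, stretch_eq_add]
    module
  have e1 : Z + w - X = ((2 - lam) * d) • lastVec m + w := by rw [← eX]; abel
  have e2 : Z - w - X = ((2 - lam) * d) • lastVec m - w := by rw [← eX]; abel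
  have e3 : Z + w - Y = ((2 - mu) * d) • lastVec m + w := by rw [← eY]; abel
  have e4 : Z - w - Y = ((2 - mu) * d) • lastVec m - w := by rw [← eY]; abel
  have e5 : Z + w - (Z - w) = (2 : ℝ) • w := by module
  have hn (c : ℝ) (h0 : 0 ≤ c) (hc : c ≤ 5 / 4) : ‖(c * d) • lastVec m‖ ≤ 5 / 4 * d := by
    rw [norm_smul, norm_lastVec, mul_one, Real.norm_eq_abs, abs_of_nonneg (by positivity)]
    exact mul_le_mul_of_nonneg_right hc hx.le
  have hX := hn (2 - lam) (by linarith) (by linarith)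
  have hY := hn (2 - mu) (by linarith) (by linarith)
  have n1 : ‖Z + w - X‖ ≤ 3 * d := by
    rw [e1]; exact (norm_add_le _ _).trans (by linarith)
  have n2 : ‖Z - w - X‖ ≤ 3 * d := by
    rw [e2]; exact (norm_sub_le _ _).trans (by linarith)
  have n3 : ‖Z + w - Y‖ ≤ 3 * d := by
    rw [e3]; exact (norm_add_le _ _).trans (by linarith)
  have n4 : ‖Z - w - Y‖ ≤ 3 * d := by
    rw [e4]; exact (norm_sub_le _ _).trans (by linarith)
  have n5 : ‖Z + w - (Z - w)‖ ≤ 3 * d := by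
    rw [e5, norm_smul, Real.norm_eq_abs, abs_two]; linarith
  refine ⟨?_, n1, n2, n3, n4, n5⟩
  have key := stress_identity (u X) (u Y) (u (Z + w)) (u (Z - w)) (lastVec m) w lam mu 2 d
  rw [← e1, ← e2, ← e3, ← e4, ← e5, inner_lastVec, vert_sub] at key
  have hI {y z : E (m + 1)} (h : ‖z - y‖ ≤ 3 * d) :
      |inner ℝ (u z - u y) (z - y)| ≤ 3 * d * projDiff u y z := by
    rw [abs_inner_eq_norm_mul_projDiff]
    exact mul_le_mul_of_nonneg_right h (projDiff_nonneg u y z)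
  have i1 := hI n1
  have i2 := hI n2
  have i3 := hI n3
  have i4 := hI n4
  have i5 := hI n5
  have hmul {c t T : ℝ} (hc : |c| ≤ 1) (ht : |t| ≤ T) : |c * t| ≤ T := by
    rw [abs_mul]
    exact (mul_le_of_le_one_left (abs_nonneg t) hc).trans ht
  have c1 : |(2 - mu) / 2| ≤ 1 := abs_le.2 ⟨by linarith, by linarith⟩
  have c2 : |(lam - 2) / 2| ≤ 1 := abs_le.2 ⟨by linarith, by linarith⟩
  have c3 : |(lam - mu) / 4| ≤ 1 := abs_le.2 ⟨by linarith, by linarith⟩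
  have j1 := hmul c1 ((abs_add_le _ _).trans (add_le_add i1 i2))
  have j2 := hmul c2 ((abs_add_le _ _).trans (add_le_add i3 i4))
  have j3 := hmul c3 i5
  have hsum := (abs_sub _ _).trans (add_le_add ((abs_add_le _ _).trans (add_le_add j1 j2)) j3)
  rw [← key, abs_mul, abs_mul, abs_of_pos hx] at hsum
  -- Both factors have modulus at least 3/4. With edge lengths at most `3 * d`, this 1/2 yields the
  -- constant 6.
  have hc : 1 / 2 ≤ |(2 - mu) * (lam - 2)| := by
    rw [le_abs]; right; nlinarith
  have h6 := mul_le_mul_of_nonneg_right (mul_le_mul_of_nonneg_right hc hx.le)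
    (abs_nonneg (vert (u X) - vert (u Y)))
  refine le_of_mul_le_mul_left ?_ hx
  linarith

lemma rpow_sum_five_le {p a b c d e : ℝ} (hp : 1 ≤ p) (ha : 0 ≤ a) (hb : 0 ≤ b) (hc : 0 ≤ c)
    (hd : 0 ≤ d) (he : 0 ≤ e) :
    (a + b + c + d + e) ^ p ≤ 5 ^ p * (a ^ p + b ^ p + c ^ p + d ^ p + e ^ p) := by
  have hn : ∀ i ∈ Finset.univ, 0 ≤ ![a, b, c, d, e] i := by
    intro i _
    fin_cases i <;> assumption
  have h := Real.rpow_sum_le_const_mul_sum_rpow_of_nonneg Finset.univ hp hn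
  simp only [Fin.sum_univ_five, Finset.card_univ, Fintype.card_fin] at h
  refine h.trans (mul_le_mul_of_nonneg_right ?_ ?_)
  · exact Real.rpow_le_rpow_of_exponent_le (by norm_num) (by linarith)
  · have := Real.rpow_nonneg ha p
    have := Real.rpow_nonneg hb p
    have := Real.rpow_nonneg hc p
    have := Real.rpow_nonneg hd p
    have := Real.rpow_nonneg he p
    change 0 ≤ a ^ p + b ^ p + c ^ p + d ^ p + e ^ p
    positivity

lemma ofReal_abs_vert_sub_rpow_le {m : ℕ} (f : E m → ℝ) (u : E (m + 1) → E (m + 1))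
    {s p lam mu : ℝ} (hs : 0 < s) (hp : 1 ≤ p)
    (hlam : |lam - 1| ≤ 1 / 4) (hmu : |mu - 1| ≤ 1 / 4) {x w : E (m + 1)}
    (hx : x ∈ epigraph f) (hw : ‖w‖ ≤ height f x) :
    let X := stretch f lam x
    let Y := stretch f mu x
    let Z := stretch f 2 x
    ENNReal.ofReal (|vert (u X) - vert (u Y)| ^ p / |height f x| ^ (p * s)) ≤
      ENNReal.ofReal (6 ^ p * 5 ^ p * 3 ^ (((m + 1 : ℕ) : ℝ) + p * s) * height f x ^ (m + 1)) *
      (kern s p u X (Z + w) + kern s p u X (Z - w) + kern s p u Y (Z + w) + kern s p u Y (Z - w)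
        + kern s p u (Z - w) (Z + w)) := by
  intro X Y Z
  obtain ⟨h0, n1, n2, n3, n4, n5⟩ := abs_vert_sub_le f u hlam hmu hx hw
  rw [mem_epigraph_iff] at hx
  set d := height f x
  set q : ℝ := ((m + 1 : ℕ) : ℝ) + p * s with hq
  have hq0 : 0 ≤ q := by positivity
  have hp0 : 0 < p := by linarith
  have k (y z : E (m + 1)) : 0 ≤ projDiff u y z ^ p / ‖z - y‖ ^ q :=
    div_nonneg (Real.rpow_nonneg (projDiff_nonneg u y z) p) (Real.rpow_nonneg (norm_nonneg _) q)
  have r1 := projDiff_rpow_le u hp0 hq0 n1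
  have r2 := projDiff_rpow_le u hp0 hq0 n2
  have r3 := projDiff_rpow_le u hp0 hq0 n3
  have r4 := projDiff_rpow_le u hp0 hq0 n4
  have r5 := projDiff_rpow_le u hp0 hq0 n5
  have five := rpow_sum_five_le hp (projDiff_nonneg u X (Z + w)) (projDiff_nonneg u X (Z - w))
    (projDiff_nonneg u Y (Z + w)) (projDiff_nonneg u Y (Z - w))
    (projDiff_nonneg u (Z - w) (Z + w))
  have hpow := Real.rpow_le_rpow (abs_nonneg _) h0 hp0.le
  rw [Real.mul_rpow (by norm_num) (by simp only [projDiff]; positivity)] at hpow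
  simp only [kern]
  have a2 := add_nonneg (k X (Z + w)) (k X (Z - w))
  have a3 := add_nonneg a2 (k Y (Z + w))
  have a4 := add_nonneg a3 (k Y (Z - w))
  rw [← ENNReal.ofReal_add (k _ _) (k _ _), ← ENNReal.ofReal_add a2 (k _ _),
    ← ENNReal.ofReal_add a3 (k _ _), ← ENNReal.ofReal_add a4 (k _ _),
    ← ENNReal.ofReal_mul (by positivity)]
  refine ENNReal.ofReal_le_ofReal ?_
  rw [abs_of_pos hx, div_le_iff₀ (Real.rpow_pos_of_pos hx _)]
  -- The factor `d ^ (p * s)` matches the weight on the left; `d ^ (m + 1)` is left for the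
  -- averaging.
  have hdq : (3 * d) ^ q = 3 ^ q * (d ^ (m + 1) * d ^ (p * s)) := by
    rw [Real.mul_rpow (by norm_num) hx.le, hq, Real.rpow_add hx, Real.rpow_natCast]
  have hsum := add_le_add (add_le_add (add_le_add (add_le_add r1 r2) r3) r4) r5
  rw [hdq] at hsum
  calc _ ≤ _ := hpow
    _ ≤ _ := mul_le_mul_of_nonneg_left
      (five.trans (mul_le_mul_of_nonneg_left hsum (by positivity))) (by positivity)
    _ = _ := by ring

/-! ### The kernel as a function on pairs -/

lemma measurable_kern {n : ℕ} (s p : ℝ) {u : E n → E n} (hu : Measurable u) :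
    Measurable fun z : E n × E n => kern s p u z.1 z.2 := by
  have h1 : Measurable fun z : E n × E n => u z.2 - u z.1 := by fun_prop
  have h2 : Measurable fun z : E n × E n => ‖z.2 - z.1‖ := by fun_prop
  have h3 : Measurable fun z : E n × E n => ‖z.2 - z.1‖⁻¹ • (z.2 - z.1) := by fun_prop
  have h4 : Measurable fun z : E n × E n => projDiff u z.1 z.2 := by
    unfold projDiff
    simp_rw [← Real.norm_eq_abs]
    exact (h1.inner h3).norm
  unfold kern
  exact ((h4.pow_const p).div (h2.pow_const _)).ennreal_ofReal

/-- Integration over pairs in centre and half-difference coordinates. -/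
lemma lintegral_lintegral_sub_add {n : ℕ} {g : E n × E n → ℝ≥0∞} (hg : Measurable g) :
    ∫⁻ z, ∫⁻ w, g (z - w, z + w) = ENNReal.ofReal (2 ^ n)⁻¹ * ∫⁻ x, ∫⁻ y, g (x, y) := by
  have h1 : Measurable fun q : E n × E n => g (q.1 - q.2, q.1 + q.2) := by fun_prop
  have h2 : Measurable fun q : E n × E n => g (q.1, q.1 + (2 : ℝ) • q.2) := by fun_prop
  calc ∫⁻ z, ∫⁻ w, g (z - w, z + w) = ∫⁻ w, ∫⁻ z, g (z - w, z + w) :=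
        lintegral_lintegral_swap h1.aemeasurable
    _ = ∫⁻ w, ∫⁻ z, g (z, z + (2 : ℝ) • w) := by
        refine lintegral_congr fun w => ?_
        rw [← lintegral_sub_right_eq_self (fun z => g (z, z + (2 : ℝ) • w)) w]
        refine lintegral_congr fun z => ?_
        congr 2
        module
    _ = ∫⁻ z, ∫⁻ w, g (z, z + (2 : ℝ) • w) :=
        (lintegral_lintegral_swap h2.aemeasurable).symm
    _ = ∫⁻ z, ENNReal.ofReal (2 ^ n)⁻¹ * ∫⁻ y, g (z, y) := by
        refine lintegral_congr fun z => ?_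
        rw [lintegral_comp_smul_real (g := fun w => g (z, z + w)) (by fun_prop) two_pos,
          lintegral_add_left_eq_self (fun y => g (z, y)), finrank_euclideanSpace_fin]
    _ = _ := lintegral_const_mul' _ _ ENNReal.ofReal_ne_top

/-- The integrand of `semiPow`, extended by zero outside `D × D`. -/
noncomputable def kernOn {n : ℕ} (s p : ℝ) (D : Set (E n)) (u : E n → E n) : E n × E n → ℝ≥0∞ :=
  (D ×ˢ D).indicator fun z => kern s p u z.1 z.2

lemma measurable_kernOn {n : ℕ} (s p : ℝ) {D : Set (E n)} (hD : MeasurableSet D) {u : E n → E n}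
    (hu : Measurable u) : Measurable (kernOn s p D u) :=
  (measurable_kern s p hu).indicator (hD.prod hD)

lemma kernOn_of_mem {n : ℕ} (s p : ℝ) {D : Set (E n)} (u : E n → E n) {x y : E n}
    (hx : x ∈ D) (hy : y ∈ D) : kernOn s p D u (x, y) = kern s p u x y :=
  Set.indicator_of_mem (Set.mk_mem_prod hx hy) _

lemma lintegral_kernOn {n : ℕ} (s p : ℝ) {D : Set (E n)} (hD : MeasurableSet D) (u : E n → E n) :
    ∫⁻ x, ∫⁻ y, kernOn s p D u (x, y) = semiPow s p D u := by
  rw [semiPow_eq, ← lintegral_indicator hD]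
  refine lintegral_congr fun x => ?_
  by_cases hx : x ∈ D
  · rw [Set.indicator_of_mem hx, ← lintegral_indicator hD]
    refine lintegral_congr fun y => ?_
    by_cases hy : y ∈ D
    · rw [kernOn_of_mem s p u hx hy, Set.indicator_of_mem hy]
    · rw [kernOn, Set.indicator_of_notMem (fun h => hy h.2), Set.indicator_of_notMem hy]
  · rw [Set.indicator_of_notMem hx]
    simp [kernOn, hx]

/-! ### Averaging over `w` and integrating over the epigraph -/

/-- The constant of the averaged estimate. -/
noncomputable def avgConst (m : ℕ) (s p M : ℝ) : ℝ :=
  6 ^ p * 5 ^ p * 3 ^ (((m + 1 : ℕ) : ℝ) + p * s) /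
    ((1 + M)⁻¹ ^ (m + 1) * (volume (Metric.ball (0 : E (m + 1)) 1)).toReal)

lemma toReal_volume_ball_pos (n : ℕ) : 0 < (volume (Metric.ball (0 : E n) 1)).toReal :=
  ENNReal.toReal_pos (Metric.measure_ball_pos volume _ one_pos).ne' measure_ball_lt_top.ne

lemma avgConst_pos (m : ℕ) (s p : ℝ) {M : ℝ} (hM : 0 ≤ M) : 0 < avgConst m s p M := by
  have := toReal_volume_ball_pos (m + 1)
  unfold avgConst
  positivity

/-- The left side is independent of `w`, so the pointwise bound is integrated over a ball and
divided by its volume. Translation and reflection in `w` merge the terms `Z + w` and `Z - w`, whence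
the factors 2. -/
lemma ofReal_abs_vert_sub_rpow_le_lintegral {m : ℕ} {f : E m → ℝ} {M : ℝ≥0}
    (hf : LipschitzWith M f) {u : E (m + 1) → E (m + 1)} (hu : Measurable u)
    {s p lam mu : ℝ} (hs : 0 < s) (hp : 1 ≤ p)
    (hlam : |lam - 1| ≤ 1 / 4) (hmu : |mu - 1| ≤ 1 / 4) {x : E (m + 1)} (hx : x ∈ epigraph f) :
    let g := kernOn s p (epigraph f) u
    let X := stretch f lam x
    let Y := stretch f mu x
    let Z := stretch f 2 x
    ENNReal.ofReal (|vert (u X) - vert (u Y)| ^ p / |height f x| ^ (p * s)) ≤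
      ENNReal.ofReal (avgConst m s p M) *
        (2 * (∫⁻ y, g (X, y)) + 2 * (∫⁻ y, g (Y, y)) + ∫⁻ w, g (Z - w, Z + w)) := by
  intro g X Y Z
  have hD := measurableSet_epigraph hf.continuous
  have hg : Measurable g := measurable_kernOn s p hD hu
  have hXD : X ∈ epigraph f :=
    (stretch_mem_epigraph_iff f (by linarith [(abs_le.1 hlam).1]) x).2 hx
  have hYD : Y ∈ epigraph f :=
    (stretch_mem_epigraph_iff f (by linarith [(abs_le.1 hmu).1]) x).2 hx
  have hd : 0 < height f x := (mem_epigraph_iff f x).1 hx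
  set d := height f x
  set A := ENNReal.ofReal (|vert (u X) - vert (u Y)| ^ p / |d| ^ (p * s))
  set K : ℝ := 6 ^ p * 5 ^ p * 3 ^ (((m + 1 : ℕ) : ℝ) + p * s)
  set b := (volume (Metric.ball (0 : E (m + 1)) 1)).toReal
  have hb : 0 < b := toReal_volume_ball_pos (m + 1)
  have hK : 0 < K := by positivity
  set r : ℝ := (1 + (M : ℝ))⁻¹
  have hM : (0 : ℝ) < 1 + M := by positivity
  have hr : 0 < r := inv_pos.2 hM
  have hr1 : r ≤ 1 := inv_le_one_of_one_le₀ (by linarith [M.coe_nonneg])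
  set G : E (m + 1) → ℝ≥0∞ := fun w =>
    g (X, Z + w) + g (X, Z - w) + g (Y, Z + w) + g (Y, Z - w) + g (Z - w, Z + w)
  have hpt : ∀ w ∈ Metric.ball (0 : E (m + 1)) (r * d),
      A ≤ ENNReal.ofReal (K * d ^ (m + 1)) * G w := by
    intro w hw
    rw [mem_ball_zero_iff] at hw
    have hw1 : (1 + (M : ℝ)) * ‖w‖ < d := by
      have := mul_lt_mul_of_pos_left hw hM
      rwa [← mul_assoc, mul_inv_cancel₀ hM.ne', one_mul] at this
    have hwZ : (1 + (M : ℝ)) * ‖w‖ < height f Z := by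
      rw [height_stretch]; linarith
    have hwd : ‖w‖ ≤ d := hw.le.trans (mul_le_of_le_one_left hd.le hr1)
    have hp1 : Z + w ∈ epigraph f := add_mem_epigraph hf hwZ
    have hp2 : Z - w ∈ epigraph f := by
      rw [sub_eq_add_neg]
      exact add_mem_epigraph hf (by rwa [norm_neg])
    simp only [G, g]
    rw [kernOn_of_mem s p u hXD hp1, kernOn_of_mem s p u hXD hp2, kernOn_of_mem s p u hYD hp1,
      kernOn_of_mem s p u hYD hp2, kernOn_of_mem s p u hp2 hp1]
    exact ofReal_abs_vert_sub_rpow_le f u hs hp hlam hmu hx hwd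
  have hadd (V : E (m + 1)) : ∫⁻ w, g (V, Z + w) = ∫⁻ y, g (V, y) :=
    lintegral_add_left_eq_self (fun y => g (V, y)) Z
  have hsub (V : E (m + 1)) : ∫⁻ w, g (V, Z - w) = ∫⁻ y, g (V, y) :=
    lintegral_sub_left_eq_self (fun y => g (V, y)) Z
  have hG : ∫⁻ w, G w =
      2 * (∫⁻ y, g (X, y)) + 2 * (∫⁻ y, g (Y, y)) + ∫⁻ w, g (Z - w, Z + w) := by
    simp only [G]
    rw [lintegral_add_left (by fun_prop), lintegral_add_left (by fun_prop),
      lintegral_add_left (by fun_prop), lintegral_add_left (by fun_prop), hadd, hsub, hadd, hsub]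
    ring
  have hvol : volume (Metric.ball (0 : E (m + 1)) (r * d)) =
      ENNReal.ofReal (r ^ (m + 1) * b * d ^ (m + 1)) := by
    rw [Measure.addHaar_ball_of_pos _ _ (by positivity), finrank_euclideanSpace_fin,
      show r ^ (m + 1) * b * d ^ (m + 1) = (r * d) ^ (m + 1) * b by ring,
      ENNReal.ofReal_mul (by positivity), ENNReal.ofReal_toReal measure_ball_lt_top.ne]
  have hint : A * ENNReal.ofReal (r ^ (m + 1) * b * d ^ (m + 1)) ≤
      ENNReal.ofReal (K * d ^ (m + 1)) * ∫⁻ w, G w := by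
    rw [← hvol, ← setLIntegral_const, ← lintegral_const_mul' _ _ ENNReal.ofReal_ne_top]
    exact (setLIntegral_mono' measurableSet_ball hpt).trans (setLIntegral_le_lintegral _ _)
  rw [hG] at hint
  have hc : 0 < r ^ (m + 1) * b * d ^ (m + 1) := by positivity
  calc A = A * ENNReal.ofReal (r ^ (m + 1) * b * d ^ (m + 1)) *
        ENNReal.ofReal (r ^ (m + 1) * b * d ^ (m + 1))⁻¹ := by
        rw [mul_assoc, ← ENNReal.ofReal_mul hc.le, mul_inv_cancel₀ hc.ne', ENNReal.ofReal_one,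
          mul_one]
    _ ≤ _ := mul_le_mul_left hint _
    _ = _ := by
        rw [mul_right_comm, ← ENNReal.ofReal_mul (by positivity)]
        congr 2
        rw [show avgConst m s p M = K / (r ^ (m + 1) * b) from rfl]
        clear_value K r b
        field_simp

lemma setLIntegral_abs_vert_sub_rpow_le {m : ℕ} {f : E m → ℝ} {M : ℝ≥0}
    (hf : LipschitzWith M f) {u : E (m + 1) → E (m + 1)} (hu : Measurable u)
    {s p lam mu : ℝ} (hs : 0 < s) (hp : 1 ≤ p)
    (hlam : |lam - 1| ≤ 1 / 4) (hmu : |mu - 1| ≤ 1 / 4) :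
    ∫⁻ x in epigraph f, ENNReal.ofReal
        (|vert (u (stretch f lam x)) - vert (u (stretch f mu x))| ^ p / |height f x| ^ (p * s)) ≤
      ENNReal.ofReal (9 * avgConst m s p M) * semiPow s p (epigraph f) u := by
  have hD := measurableSet_epigraph hf.continuous
  set g := kernOn s p (epigraph f) u
  have hg : Measurable g := measurable_kernOn s p hD hu
  have hS : ∫⁻ x, ∫⁻ y, g (x, y) = semiPow s p (epigraph f) u := lintegral_kernOn s p hD u
  set S := semiPow s p (epigraph f) u
  have hH : Measurable fun x => ∫⁻ y, g (x, y) := hg.lintegral_prod_right'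
  have hQ : Measurable fun z => ∫⁻ w, g (z - w, z + w) := by
    have : Measurable fun q : E (m + 1) × E (m + 1) => g (q.1 - q.2, q.1 + q.2) := by fun_prop
    exact this.lintegral_prod_right'
  have hst (η : ℝ) := (continuous_stretch hf.continuous η).measurable
  have hle {η : ℝ} (hη : |η - 1| ≤ 1 / 4) :
      ∫⁻ x in epigraph f, ∫⁻ y, g (stretch f η x, y) ≤ 2 * S := by
    have hη1 : 1 / 2 ≤ η := by linarith [(abs_le.1 hη).1]
    rw [setLIntegral_comp_stretch hf.continuous (by linarith) hH, ← hS]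
    refine mul_le_mul' ?_ (setLIntegral_le_lintegral _ _)
    rw [← ENNReal.ofReal_ofNat 2]
    refine ENNReal.ofReal_le_ofReal ?_
    rw [inv_le_comm₀ (by linarith) two_pos]
    linarith
  -- The stretch makes `Z` a free centre; centre and half-difference then run over all pairs, and
  -- both Jacobian factors are at most 1.
  have hQle : ∫⁻ x in epigraph f, ∫⁻ w, g (stretch f 2 x - w, stretch f 2 x + w) ≤ S := by
    rw [setLIntegral_comp_stretch hf.continuous two_pos hQ]
    calc _ ≤ 1 * ∫⁻ z, ∫⁻ w, g (z - w, z + w) := by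
          refine mul_le_mul' ?_ (setLIntegral_le_lintegral _ _)
          rw [ENNReal.ofReal_le_one]
          norm_num
      _ ≤ 1 * (1 * S) := by
          rw [lintegral_lintegral_sub_add hg, hS]
          refine mul_le_mul_right (mul_le_mul_left ?_ _) _
          rw [ENNReal.ofReal_le_one]
          exact inv_le_one_of_one_le₀ (one_le_pow₀ one_le_two)
      _ = S := by rw [one_mul, one_mul]
  have hX : Measurable fun x => 2 * ∫⁻ y, g (stretch f lam x, y) :=
    (hH.comp (hst lam)).const_mul 2
  have hY : Measurable fun x => 2 * ∫⁻ y, g (stretch f mu x, y) :=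
    (hH.comp (hst mu)).const_mul 2
  calc _ ≤ ∫⁻ x in epigraph f, ENNReal.ofReal (avgConst m s p M) *
        (2 * (∫⁻ y, g (stretch f lam x, y)) + 2 * (∫⁻ y, g (stretch f mu x, y))
          + ∫⁻ w, g (stretch f 2 x - w, stretch f 2 x + w)) :=
        setLIntegral_mono' hD fun x hx =>
          ofReal_abs_vert_sub_rpow_le_lintegral hf hu hs hp hlam hmu hx
    _ = ENNReal.ofReal (avgConst m s p M) *
        (2 * (∫⁻ x in epigraph f, ∫⁻ y, g (stretch f lam x, y))
          + 2 * (∫⁻ x in epigraph f, ∫⁻ y, g (stretch f mu x, y))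
          + ∫⁻ x in epigraph f, ∫⁻ w, g (stretch f 2 x - w, stretch f 2 x + w)) := by
        rw [lintegral_const_mul' _ _ ENNReal.ofReal_ne_top, lintegral_add_left (by exact hX.add hY),
          lintegral_add_left hX, lintegral_const_mul' _ _ ENNReal.ofNat_ne_top,
          lintegral_const_mul' _ _ ENNReal.ofNat_ne_top]
    -- The inner factors 2 bound the Jacobians `lam⁻¹` and `mu⁻¹`; the total is 9.
    _ ≤ ENNReal.ofReal (avgConst m s p M) * (2 * (2 * S) + 2 * (2 * S) + S) := by
        gcongr
        · exact hle hlam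
        · exact hle hmu
    _ = _ := by
        rw [mul_comm (9 : ℝ), ENNReal.ofReal_mul (avgConst_pos m s p M.coe_nonneg).le, mul_assoc,
          ENNReal.ofReal_ofNat]
        ring

lemma semiPow_congr {n : ℕ} (s p : ℝ) {D : Set (E n)} {u v : E n → E n}
    (h : u =ᵐ[volume.restrict D] v) : semiPow s p D u = semiPow s p D v := by
  refine lintegral_congr_ae ?_
  filter_upwards [h] with x hx
  refine lintegral_congr_ae ?_
  filter_upwards [h] with y hy
  rw [hx, hy]

end FracKorn

theorem lemma2p4 (m : ℕ) (hm : 1 ≤ m) :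
    ∃ c₂ : ℝ, 1 ≤ c₂ ∧
      ∀ (s p : ℝ), 0 < s → s < 1 → 1 < p → ∀ M : ℝ≥0,
        ∃ C : ℝ, 0 < C ∧
          ∀ f : FracKorn.E m → ℝ, LipschitzWith M f →
          ∀ δ : ℝ, δ = 1 / (2 * c₂ * Real.sqrt ((m + 1 : ℕ) : ℝ) * (2 + (M : ℝ))) →
          ∀ lam ∈ Set.Icc (1 - δ) (1 + δ), ∀ mu ∈ Set.Icc (1 - δ) (1 + δ),
          ∀ u : FracKorn.E (m + 1) → FracKorn.E (m + 1),
            FracKorn.MemX s p (FracKorn.epigraph f) u →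
            ∫⁻ x in FracKorn.epigraph f,
                ENNReal.ofReal
                  (|FracKorn.vert (u (FracKorn.stretch f lam x))
                      - FracKorn.vert (u (FracKorn.stretch f mu x))| ^ p
                    / |FracKorn.vert x - f (FracKorn.horiz x)| ^ (p * s))
              ≤ ENNReal.ofReal C * FracKorn.semiPow s p (FracKorn.epigraph f) u := by
  refine ⟨1, le_rfl, fun s p hs _ hp M => ⟨9 * FracKorn.avgConst m s p M,
    mul_pos (by norm_num) (FracKorn.avgConst_pos m s p M.coe_nonneg), ?_⟩⟩
  intro f hf δ hδ lam hlam mu hmu u hu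
  -- With `c₂ = 1` the denominator of `δ` is at least `2 * 1 * 1 * 2`.
  have hδ4 : δ ≤ 1 / 4 := by
    have h1 : 1 ≤ Real.sqrt ((m + 1 : ℕ) : ℝ) := by
      rw [Real.one_le_sqrt]
      exact_mod_cast Nat.le_add_left 1 m
    have h2 := M.coe_nonneg
    rw [hδ]
    refine one_div_le_one_div_of_le (by norm_num) ?_
    nlinarith
  have hlam' : |lam - 1| ≤ 1 / 4 := abs_le.2 ⟨by linarith [hlam.1], by linarith [hlam.2]⟩
  have hmu' : |mu - 1| ≤ 1 / 4 := abs_le.2 ⟨by linarith [hmu.1], by linarith [hmu.2]⟩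
  obtain ⟨v, hv, huv⟩ := hu.1
  have h1 := FracKorn.ae_comp_stretch hf.continuous (η := lam)
    (by linarith [(abs_le.1 hlam').1]) huv
  have h2 := FracKorn.ae_comp_stretch hf.continuous (η := mu)
    (by linarith [(abs_le.1 hmu').1]) huv
  rw [FracKorn.semiPow_congr s p huv]
  refine le_trans (le_of_eq (lintegral_congr_ae ?_))
    (FracKorn.setLIntegral_abs_vert_sub_rpow_le hf hv.measurable hs hp.le hlam' hmu')
  filter_upwards [h1, h2] with x hx1 hx2
  rw [hx1, hx2, FracKorn.height]
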